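/- Let $d$ be a natural number, $R>0$ and $0<\lambda_{\min}<\lambda_{\max}$. Let $\mathbb S=\mathbb S_d^+(\lambda_{\min},\lambda_{\max})$ be the set of symmetric positive-definite $d\times d$ matrices with all eigenvalues in $[\lambda_{\min},\lambda_{\max}]$, and let $\mathcal X\subseteq\{x\in\mathbb R^d:\|x\|\le R\}$ be measurable. Let $f(x\mid\theta,\Sigma)$ be a density kernel on $\mathbb R^d$ with location parameter $\theta\in\mathbb R^d$ and scale $\Sigma\in\mathbb S$: each $f(\cdot\mid 0,\Sigma)$ is a probability density and $f(x\mid\theta,\Sigma)=f(x-\theta\mid 0,\Sigma)$ (for example $f(x\mid\theta,\Sigma)=|\Sigma|^{-1/2}g((x-\theta)^\top\Sigma^{-1}(x-\theta))$). Put $\Phi_\Sigma(\xi)=\int_{\mathbb R^d}e^{i\xi^\top x}f(x\mid0,\Sigma)\,dx$. Let $\mathscr G$ be the set of mixing measures $G=P\times\delta_\Sigma$ with $P$ a probability measure on $\mathbb R^d$, $\mathrm{supp}(P)\subseteq\mathcal X$, and $\Sigma\in\mathbb S$, and put $p_G(x)=\int f(x\mid\theta,\Sigma)\,P(d\theta)$.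 Let $\|\cdot\|_1$ be the norm of $L^1(\mathbb R^d)$, $\|\cdot\|_{\mathrm{op}}$ the operator norm, and $W_1$ the Wasserstein distance of order $1$ for the Euclidean metric. Suppose that, with constants $A_1,A_2,c_1,c_2,\alpha>0$ and $p\ge1$: 1. there is a strictly increasing $\Psi:[0,\infty)\to[0,\infty)$ with $\|p_G-p_{G'}\|_1\ge A_1\Psi(\|\Sigma-\Sigma'\|_{\mathrm{op}})$ for all $G=P\times\delta_\Sigma$, $G'=P'\times\delta_{\Sigma'}$ in $\mathscr G$; 2. there is a strictly increasing $\Xi:[0,\infty)\to[0,\infty)$ with $|\Phi_{\Sigma'}(\xi)-\Phi_\Sigma(\xi)|\le A_2\,\Xi(\|\Sigma-\Sigma'\|_{\mathrm{op}})\,\|\xi\|^p\max\{|\Phi_{\Sigma'}(\xi)|,|\Phi_\Sigma(\xi)|\}$ for all $\xi\in\mathbb R^d$ and $\Sigma,\Sigma'\in\mathbb S$; 3. $f$ is super-smooth of order $\alpha$: $\exp(-c_1\|\xi\|^\alpha)\le|\Phi_\Sigma(\xi)|\le\exp(-c_2\|\xi\|^\alpha)$ for all $\xi\in\mathbb R^d$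 and $\Sigma\in\mathbb S$. Then there exist $C,\widetilde C,C'>0$, depending only on $d,R,\lambda_{\min},\lambda_{\max},p,\alpha,c_1,c_2,A_1,A_2$ (and not otherwise on $f,\mathcal X,\Psi,\Xi$), such that for all $G=P\times\delta_\Sigma$ and $G'=P'\times\delta_{\Sigma'}$ in $\mathscr G$ $$\|p_G-p_{G'}\|_1\ \ge\ C'\left[\Psi(\|\Sigma-\Sigma'\|_{\mathrm{op}})+\min\left\{\exp\left(-\frac{C}{W_1(P,P')^\alpha}\right),\ (\Psi\circ\Xi^{-1})\left(\widetilde C\exp\left(-\frac{C}{W_1(P,P')^\alpha}\right)\right)\right\}\right].$$ Here $\exp(-C/0^\alpha)=0$, and $\Xi^{-1}(y)=\inf\{t\ge0:\Xi(t)\ge y\}$, which is the inverse of $\Xi$ on its range; if $y$ exceeds every value of $\Xi$, then $\Xi^{-1}(y)=\infty$ and $\Psi(\infty)=\infty$, so that the minimum is its first entry. -/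

import Mathlib

open MeasureTheory
open scoped NNReal ENNReal

noncomputable section

/-- `ℝᵈ` with the Euclidean norm. -/
abbrev Space (d : ℕ) : Type := EuclideanSpace ℝ (Fin d)

/-- `𝕊_d⁺(lmin, lmax)`: the symmetric positive-definite matrices whose eigenvalues all lie
in `[lmin, lmax]`. -/
def scaleSet (d : ℕ) (lmin lmax : ℝ) : Set (Matrix (Fin d) (Fin d) ℝ) :=
  {S | S.PosDef ∧ spectrum ℝ S ⊆ Set.Icc lmin lmax}

/-- The operator norm of a matrix with respect to the Euclidean norm. -/
def opNorm {d : ℕ} (S : Matrix (Fin d) (Fin d) ℝ) : ℝ≥0 :=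
  ‖Matrix.toEuclideanCLM (n := Fin d) (𝕜 := ℝ) S‖₊

/-- `f x θ S` stands for `f(x ∣ θ, S)`. For each scale `S` in `𝒮`, `f(· ∣ 0, S)` is a probability
density on `ℝᵈ` and `θ` is a location parameter: `f(x ∣ θ, S) = f(x - θ ∣ 0, S)`. -/
structure IsDensityKernel {d : ℕ} (𝒮 : Set (Matrix (Fin d) (Fin d) ℝ))
    (f : Space d → Space d → Matrix (Fin d) (Fin d) ℝ → ℝ) : Prop where
  measurable : ∀ S ∈ 𝒮, Measurable fun x => f x 0 S
  nonneg : ∀ S ∈ 𝒮, ∀ x, 0 ≤ f x 0 S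
  integral_eq_one : ∀ S ∈ 𝒮, ∫ x, f x 0 S = 1
  location : ∀ S ∈ 𝒮, ∀ x θ, f x θ S = f (x - θ) 0 S

/-- `Φ_S(ξ) = ∫ exp(i ξᵀx) f(x ∣ 0, S) dx`. -/
def kernelCharFun {d : ℕ} (f : Space d → Space d → Matrix (Fin d) (Fin d) ℝ → ℝ)
    (S : Matrix (Fin d) (Fin d) ℝ) (ξ : Space d) : ℂ :=
  ∫ x, Complex.exp (Complex.I * (inner ℝ ξ x : ℝ)) * (f x 0 S : ℂ)

/-- The mixture density `p_G(x) = ∫ f(x ∣ θ, S) P(dθ)` of `G = P × δ_S`. -/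
def mixtureDensity {d : ℕ} (f : Space d → Space d → Matrix (Fin d) (Fin d) ℝ → ℝ)
    (P : Measure (Space d)) (S : Matrix (Fin d) (Fin d) ℝ) (x : Space d) : ℝ :=
  ∫ θ, f x θ S ∂P

/-- `‖p - q‖₁ = ∫ |p(x) - q(x)| dx`. -/
def l1Dist {d : ℕ} (p q : Space d → ℝ) : ℝ≥0∞ :=
  ∫⁻ x, ‖p x - q x‖ₑ

/-- `G = P × δ_S` belongs to the parameter space `𝒢`: `P` is a probability measure with support
in `𝒳`, and `S ∈ 𝕊_d⁺(lmin, lmax)`. A measure `G` of this form is given by the pair `(P, S)`. -/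
def MemMixing {d : ℕ} (𝒳 : Set (Space d)) (lmin lmax : ℝ)
    (P : Measure (Space d)) (S : Matrix (Fin d) (Fin d) ℝ) : Prop :=
  IsProbabilityMeasure P ∧ P.support ⊆ 𝒳 ∧ S ∈ scaleSet d lmin lmax

/-- The Wasserstein distance `W₁`: the infimum of `∫ ‖x - y‖ dπ(x, y)` over all couplings `π`
of `P` and `P'`. (The infimum is finite when `P` and `P'` have bounded support.) -/
def wasserstein1 {d : ℕ} (P P' : Measure (Space d)) : ℝ≥0 :=
  (⨅ π ∈ {π : Measure (Space d × Space d) | π.fst = P ∧ π.snd = P'},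
    ∫⁻ z, edist z.1 z.2 ∂π).toNNReal

/-- The scale is identified by the mixture density with modulus `Ψ`:
`‖p_G - p_G'‖₁ ≥ A Ψ(‖S - S'‖_op)` on `𝒢`, with `Ψ : [0,∞) → [0,∞)` strictly increasing. -/
def ScaleIdentifiable {d : ℕ} (f : Space d → Space d → Matrix (Fin d) (Fin d) ℝ → ℝ)
    (𝒳 : Set (Space d)) (lmin lmax : ℝ) (A : ℝ≥0) (Ψ : ℝ≥0 → ℝ≥0) : Prop :=
  StrictMono Ψ ∧ ∀ P P' S S', MemMixing 𝒳 lmin lmax P S → MemMixing 𝒳 lmin lmax P' S' →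
    (A : ℝ≥0∞) * Ψ (opNorm (S - S')) ≤ l1Dist (mixtureDensity f P S) (mixtureDensity f P' S')

/-- The characteristic function varies with the scale in a controlled manner:
`|Φ_S'(ξ) - Φ_S(ξ)| ≤ A Ξ(‖S - S'‖_op) ‖ξ‖^p max{|Φ_S'(ξ)|, |Φ_S(ξ)|}`, with
`Ξ : [0,∞) → [0,∞)` strictly increasing. -/
def CharFunControlled {d : ℕ} (f : Space d → Space d → Matrix (Fin d) (Fin d) ℝ → ℝ)
    (lmin lmax p : ℝ) (A : ℝ≥0) (Ξ : ℝ≥0 → ℝ≥0) : Prop :=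
  StrictMono Ξ ∧ ∀ ξ : Space d, ∀ S ∈ scaleSet d lmin lmax, ∀ S' ∈ scaleSet d lmin lmax,
    ‖kernelCharFun f S' ξ - kernelCharFun f S ξ‖ ≤
      A * Ξ (opNorm (S - S')) * ‖ξ‖ ^ p * max ‖kernelCharFun f S' ξ‖ ‖kernelCharFun f S ξ‖

/-- Super-smoothness of order `α`, with constants `c₁` and `c₂`. -/
def SuperSmooth {d : ℕ} (f : Space d → Space d → Matrix (Fin d) (Fin d) ℝ → ℝ)
    (lmin lmax α c₁ c₂ : ℝ) : Prop :=
  ∀ ξ : Space d, ∀ S ∈ scaleSet d lmin lmax,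
    Real.exp (-c₁ * ‖ξ‖ ^ α) ≤ ‖kernelCharFun f S ξ‖ ∧
      ‖kernelCharFun f S ξ‖ ≤ Real.exp (-c₂ * ‖ξ‖ ^ α)

/-- `exp(-C / w^α)`, with its limiting value `0` at `w = 0`. -/
def expRate (C : ℝ≥0) (α : ℝ) (w : ℝ≥0) : ℝ≥0 :=
  if w = 0 then 0 else Real.toNNReal (Real.exp (-(C / w ^ α)))

/-- The inverse `Ξ⁻¹(y) = inf {t ≥ 0 : y ≤ Ξ(t)}` of an increasing function on `[0,∞)`, with
`inf ∅ = ∞`. It is the true inverse on the range of a strictly increasing `Ξ`; no continuity or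
surjectivity is needed for it to be defined elsewhere. -/
def genInv (Ξ : ℝ≥0 → ℝ≥0) (y : ℝ≥0) : ℝ≥0∞ :=
  ⨅ t ∈ {t : ℝ≥0 | y ≤ Ξ t}, (t : ℝ≥0∞)

/-- The extension of `Ψ` to `[0,∞]` by `Ψ(∞) = ∞`. -/
def extendTop (Ψ : ℝ≥0 → ℝ≥0) (s : ℝ≥0∞) : ℝ≥0∞ :=
  if s = ∞ then ∞ else Ψ s.toNNReal

end

/-! Write `V` for the L¹ distance, `δ = ‖Σ - Σ'‖`, `w = W₁(P, P')`, `φ` for characteristic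
functions. Since `p_G` is a convolution, `V` bounds `|φ_P Φ_Σ - φ_P' Φ_Σ'|` at every frequency.
Replacing the smaller of `|Φ_Σ|`, `|Φ_Σ'|` by the larger costs at most `A₂ Ξ(δ) ‖ξ‖^p` times the
larger, so dividing by the larger leaves this term free of exponentials: `|φ_P - φ_P'| ≤ D := V
exp(c₁ T^α) + A₂ Ξ(δ) T^p` for `‖ξ‖ ≤ T`.

This is turned into a transport bound by smoothing at scale `h` with a density `k` whose Fourier
transform has bounded support. The smoothed densities see only frequencies up to `T = 4 / h`, hence
differ by `O(h^{-d} D)` pointwise. Couple `X` and `X'` through the common part of their smoothed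
laws, at cost `O(h)`; the remaining mass is `O(h^{-d} D + h)` and moves at most `2R`. Thus `w ≤ m h
+ K h^{-d} D`.

With `h = w / (2m)` half of `w` is absorbed and `w^{d+1} ≲ D`. One term of `D` carries half of this,
and powers of `w` are absorbed in the exponential. Either `V ≳ exp(-C / w^α)`, or `Ξ(δ) ≳ exp(-C /
w^α)`; in the latter case `Ξ⁻¹` of the right side is at most `δ`, and `V ≥ A₁ Ψ(δ)` concludes. -/

/-! ### Couplings through a common part -/

section Coupling

open ProbabilityTheory

variable {E : Type*} [NormedAddCommGroup E] [MeasurableSpace E]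
  [SecondCountableTopology E]

/-- The normalised product measure works, as points of the ball are within `2 * R`; zero mass cannot
be normalised and is treated apart. -/
lemma exists_coupling_of_univ_eq {a b : Measure E} [IsFiniteMeasure a] [IsFiniteMeasure b]
    {R : ℝ} (hab : a Set.univ = b Set.univ) (ha : ∀ᵐ x ∂a, ‖x‖ ≤ R) (hb : ∀ᵐ x ∂b, ‖x‖ ≤ R) :
    ∃ π : Measure (E × E), π.fst = a ∧ π.snd = b ∧
      ∫⁻ z, edist z.1 z.2 ∂π ≤ ENNReal.ofReal (2 * R) * a Set.univ := by
  by_cases h0 : a Set.univ = 0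
  · have ha0 : a = 0 := Measure.measure_univ_eq_zero.1 h0
    have hb0 : b = 0 := Measure.measure_univ_eq_zero.1 (hab ▸ h0)
    exact ⟨0, by simp [ha0], by simp [hb0], by simp⟩
  have hfst : ((a Set.univ)⁻¹ • a.prod b).fst = a := by
    rw [Measure.fst, Measure.map_smul, Measure.map_fst_prod, smul_smul, ← hab,
      ENNReal.inv_mul_cancel h0 (measure_ne_top _ _), one_smul]
  refine ⟨(a Set.univ)⁻¹ • a.prod b, hfst, ?_, ?_⟩
  · rw [Measure.snd, Measure.map_smul, Measure.map_snd_prod, smul_smul,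
      ENNReal.inv_mul_cancel h0 (measure_ne_top _ _), one_smul]
  · have hae : ∀ᵐ z ∂((a Set.univ)⁻¹ • a.prod b),
        edist z.1 z.2 ≤ ENNReal.ofReal (2 * R) := by
      refine Measure.ae_smul_measure ?_ _
      filter_upwards [Measure.quasiMeasurePreserving_fst.ae ha,
        Measure.quasiMeasurePreserving_snd.ae hb] with z h1 h2
      rw [edist_dist]
      refine ENNReal.ofReal_le_ofReal ?_
      rw [dist_eq_norm]
      linarith [norm_sub_le z.1 z.2]
    calc ∫⁻ z, edist z.1 z.2 ∂((a Set.univ)⁻¹ • a.prod b)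
        ≤ ∫⁻ _, ENNReal.ofReal (2 * R) ∂((a Set.univ)⁻¹ • a.prod b) := lintegral_mono_ae hae
      _ = ENNReal.ofReal (2 * R) * a Set.univ := by
        rw [lintegral_const, ← Measure.fst_univ, hfst]

/-- Two joint laws on `E × E` whose first marginals share the part `ν` give a coupling of their
second marginals: glue along `ν`, and couple the remaining mass independently. -/
lemma exists_coupling_of_common_part [BorelSpace E] [CompleteSpace E] {μ μ' : Measure (E × E)}
    [IsFiniteMeasure μ] [IsFiniteMeasure μ'] {ν ρ ρ' : Measure E} [IsFiniteMeasure ν]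
    [IsFiniteMeasure ρ] [IsFiniteMeasure ρ'] {R : ℝ} (h : μ.fst = ν + ρ) (h' : μ'.fst = ν + ρ')
    (hρ : ρ Set.univ = ρ' Set.univ) (hR : ∀ᵐ x ∂μ.snd, ‖x‖ ≤ R) (hR' : ∀ᵐ x ∂μ'.snd, ‖x‖ ≤ R) :
    ∃ π : Measure (E × E), π.fst = μ.snd ∧ π.snd = μ'.snd ∧
      ∫⁻ z, edist z.1 z.2 ∂π ≤ ∫⁻ z, edist z.1 z.2 ∂μ + ∫⁻ z, edist z.1 z.2 ∂μ' +
        ENNReal.ofReal (2 * R) * ρ Set.univ := by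
  have hsnd : ∀ (m : Measure (E × E)) [IsFiniteMeasure m] (r : Measure E) [IsFiniteMeasure r],
      m.fst = ν + r → m.snd = m.condKernel ∘ₘ ν + m.condKernel ∘ₘ r := by
    intro m _ r _ hm
    rw [← Measure.comp_add, ← hm, ← Measure.snd_compProd, m.disintegrate]
  have hcost : ∀ (m : Measure (E × E)) [IsFiniteMeasure m] (r : Measure E) [IsFiniteMeasure r],
      m.fst = ν + r →
      ∫⁻ y, ∫⁻ x, edist y x ∂(m.condKernel y) ∂ν ≤ ∫⁻ z, edist z.1 z.2 ∂m := by
    intro m _ r _ hm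
    conv_rhs => rw [← m.disintegrate m.condKernel]
    rw [Measure.lintegral_compProd (by fun_prop), hm, lintegral_add_measure]
    exact le_self_add
  set κ := μ.condKernel
  set κ' := μ'.condKernel
  have hμ := hsnd μ ρ h
  have hμ' := hsnd μ' ρ' h'
  obtain ⟨π, h1, h2, h3⟩ := exists_coupling_of_univ_eq (a := κ ∘ₘ ρ) (b := κ' ∘ₘ ρ') (R := R)
    (by simpa using hρ)
    (by rw [hμ] at hR; exact (ae_add_measure_iff.1 hR).2)
    (by rw [hμ'] at hR'; exact (ae_add_measure_iff.1 hR').2)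
  -- Draw `y` from `ν`, then both points independently given `y`; the triangle inequality through
  -- `y` bounds the cost.
  refine ⟨(κ ×ₖ κ') ∘ₘ ν + π, ?_, ?_, ?_⟩
  · rw [Measure.fst_add, h1, hμ, Measure.fst, Measure.map_comp _ _ measurable_fst,
      ← Kernel.fst_eq, Kernel.fst_prod]
  · rw [Measure.snd_add, h2, hμ', Measure.snd, Measure.map_comp _ _ measurable_snd,
      ← Kernel.snd_eq, Kernel.snd_prod]
  rw [lintegral_add_measure]
  refine add_le_add ?_ (h3.trans_eq (by simp))
  rw [Measure.lintegral_bind (Kernel.aemeasurable _) (by fun_prop)]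
  calc ∫⁻ y, ∫⁻ z, edist z.1 z.2 ∂((κ ×ₖ κ') y) ∂ν
      ≤ ∫⁻ y, (∫⁻ x, edist y x ∂(κ y) + ∫⁻ x, edist y x ∂(κ' y)) ∂ν := by
        refine lintegral_mono fun y => ?_
        rw [Kernel.prod_apply]
        calc ∫⁻ z, edist z.1 z.2 ∂((κ y).prod (κ' y))
            ≤ ∫⁻ z, (edist y z.1 + edist y z.2) ∂((κ y).prod (κ' y)) :=
              lintegral_mono fun z => edist_triangle_left _ _ _
          _ = _ := by
            rw [lintegral_add_left (by fun_prop), lintegral_prod _ (by fun_prop),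
              lintegral_prod _ (by fun_prop)]
            simp
    _ = ∫⁻ y, ∫⁻ x, edist y x ∂(κ y) ∂ν + ∫⁻ y, ∫⁻ x, edist y x ∂(κ' y) ∂ν :=
        lintegral_add_left (Measurable.lintegral_kernel_prod_right (by fun_prop)) _
    _ ≤ _ := add_le_add (hcost μ ρ h) (hcost μ' ρ' h')

lemma exists_coupling_of_density [BorelSpace E] [CompleteSpace E] {vol : Measure E} {q q' : E → ℝ≥0∞}
    (hq : Measurable q) (hq' : Measurable q') {μ μ' : Measure (E × E)} [IsProbabilityMeasure μ]
    [IsProbabilityMeasure μ'] {R : ℝ} (h : μ.fst = vol.withDensity q)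
    (h' : μ'.fst = vol.withDensity q')
    (hR : ∀ᵐ x ∂μ.snd, ‖x‖ ≤ R) (hR' : ∀ᵐ x ∂μ'.snd, ‖x‖ ≤ R) :
    ∃ π : Measure (E × E), π.fst = μ.snd ∧ π.snd = μ'.snd ∧
      ∫⁻ z, edist z.1 z.2 ∂π ≤ ∫⁻ z, edist z.1 z.2 ∂μ + ∫⁻ z, edist z.1 z.2 ∂μ' +
        ENNReal.ofReal (2 * R) * ∫⁻ y, q y - q' y ∂vol := by
  -- The shared part has density `min q q'`; truncated subtraction makes `q - q'` the positive
  -- excess.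
  have e : μ.fst = vol.withDensity (fun y => min (q y) (q' y)) +
      vol.withDensity (fun y => q y - q' y) := by
    rw [h, ← withDensity_add_left (hq.min hq')]
    congr 1
    ext y
    exact (add_comm _ _).trans tsub_add_min |>.symm
  have e' : μ'.fst = vol.withDensity (fun y => min (q y) (q' y)) +
      vol.withDensity (fun y => q' y - q y) := by
    rw [h', ← withDensity_add_left (hq.min hq')]
    congr 1
    ext y
    rw [show (fun y => min (q y) (q' y)) = fun y => min (q' y) (q y) from
      funext fun y => min_comm _ _]
    exact (add_comm _ _).trans tsub_add_min |>.symm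
  have fin1 : IsFiniteMeasure (vol.withDensity (fun y => min (q y) (q' y))) :=
    isFiniteMeasure_of_le μ.fst (e ▸ Measure.le_add_right le_rfl)
  have fin2 : IsFiniteMeasure (vol.withDensity (fun y => q y - q' y)) :=
    isFiniteMeasure_of_le μ.fst (e ▸ Measure.le_add_left le_rfl)
  have fin3 : IsFiniteMeasure (vol.withDensity (fun y => q' y - q y)) :=
    isFiniteMeasure_of_le μ'.fst (e' ▸ Measure.le_add_left le_rfl)
  have hmass : vol.withDensity (fun y => q y - q' y) Set.univ =
      vol.withDensity (fun y => q' y - q y) Set.univ := by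
    have h1 := congrArg (fun m => m Set.univ) e
    have h2 := congrArg (fun m => m Set.univ) e'
    simp only [measure_univ, Measure.add_apply] at h1 h2
    exact (ENNReal.add_right_inj (measure_ne_top _ _)).1 (h1.symm.trans h2)
  obtain ⟨π, h1, h2, h3⟩ := exists_coupling_of_common_part e e' hmass hR hR'
  refine ⟨π, h1, h2, h3.trans_eq ?_⟩
  rw [withDensity_apply _ MeasurableSet.univ, Measure.restrict_univ]

end Coupling

/-! ### A band-limited smoothing density -/

section Kernel

open scoped ContDiff FourierTransform

/-- A finite measure with bounded support whose characteristic function decays rapidly. -/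
lemma exists_charFun_integrable_pow (E : Type*) [NormedAddCommGroup E] [InnerProductSpace ℝ E]
    [FiniteDimensional ℝ E] [MeasurableSpace E] [BorelSpace E] :
    ∃ β : Measure E, IsFiniteMeasure β ∧ β ≠ 0 ∧ (∀ᵐ u ∂β, ‖u‖ ≤ 2) ∧ Continuous (charFun β) ∧
      ∀ j : ℕ, Integrable fun t => ‖t‖ ^ j * ‖charFun β t‖ := by
  let b : ContDiffBump (0 : E) := ⟨1, 2, one_pos, one_lt_two⟩
  let β : Measure E := volume.withDensity fun x => ENNReal.ofReal (b x)
  have hbm : Measurable fun x => ENNReal.ofReal (b x) := b.continuous.measurable.ennreal_ofReal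
  have hβ : β Set.univ = ENNReal.ofReal (∫ x, b x) := by
    rw [withDensity_apply _ MeasurableSet.univ, Measure.restrict_univ,
      ofReal_integral_eq_lintegral_ofReal b.integrable (ae_of_all _ b.nonneg')]
  have hfin : IsFiniteMeasure β := ⟨by rw [hβ]; exact ENNReal.ofReal_lt_top⟩
  let g : SchwartzMap E ℂ := HasCompactSupport.toSchwartzMap (f := fun x => (b x : ℂ))
    (b.hasCompactSupport.comp_left (g := fun r : ℝ => (r : ℂ)) (by simp))
    (Complex.ofRealCLM.contDiff.comp b.contDiff)
  -- `charFun` uses `exp(i⟨x, t⟩)` and `𝓕` uses `exp(-2πi⟨x, ξ⟩)`, whence this factor.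
  have hr : -(2 * Real.pi)⁻¹ ≠ 0 := neg_ne_zero.2 (by positivity)
  have hch : ∀ t, charFun β t = 𝓕 g (-(2 * Real.pi)⁻¹ • t) := by
    intro t
    rw [charFun_eq_fourierIntegral', SchwartzMap.fourier_coe]
    simp only [VectorFourier.fourierIntegral, Real.fourier_eq, β]
    rw [integral_withDensity_eq_integral_toReal_smul hbm (by simp)]
    refine integral_congr_ae (ae_of_all _ fun x => ?_)
    have hg : g x = (b x : ℂ) := rfl
    simp [hg, ENNReal.toReal_ofReal b.nonneg, Circle.smul_def, mul_comm]
  refine ⟨β, hfin, ?_, ?_, ?_, ?_⟩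
  · intro h
    have : ENNReal.ofReal (∫ x, b x) = 0 := by rw [← hβ, h]; simp
    exact absurd (ENNReal.ofReal_eq_zero.1 this) (not_le.2 b.integral_pos)
  · refine (ae_withDensity_iff hbm).2 (ae_of_all _ fun x hx => ?_)
    by_contra hcon
    exact hx (by simp [b.zero_of_le_dist (x := x) (by simpa [b] using (not_le.1 hcon).le)])
  · rw [funext hch]
    exact (𝓕 g).continuous.comp (by fun_prop)
  · intro j
    have := (((𝓕 g).integrable_pow_mul volume j).comp_smul hr).const_mul ((2 * Real.pi) ^ j)
    refine this.congr (ae_of_all _ fun t => ?_)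
    have hpi : (0:ℝ) < 2 * Real.pi := by positivity
    simp only [hch, norm_smul, norm_neg, norm_inv, Real.norm_of_nonneg hpi.le]
    rw [← mul_assoc, ← mul_pow, mul_inv_cancel_left₀ hpi.ne']

/-- A smoothing kernel: a probability density with finite first moment whose Fourier transform
has bounded support. -/
lemma exists_bandlimited_density (E : Type*) [NormedAddCommGroup E] [InnerProductSpace ℝ E]
    [FiniteDimensional ℝ E] [MeasurableSpace E] [BorelSpace E] :
    ∃ (k : E → ℝ) (ν : Measure E), IsFiniteMeasure ν ∧ (∀ᵐ u ∂ν, ‖u‖ ≤ 4) ∧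
      (∀ z, (k z : ℂ) = charFun ν z) ∧ Continuous k ∧ (∀ z, 0 ≤ k z) ∧ Integrable k ∧
      ∫ z, k z = 1 ∧ Integrable fun z => ‖z‖ * k z := by
  obtain ⟨β, hfin, hβ0, hβ, hcont, hint⟩ := exists_charFun_integrable_pow E
  -- The squared modulus is nonnegative and is the characteristic function of `β` convolved with its
  -- reflection, which lives in radius `2 + 2 = 4`.
  let k₀ : E → ℝ := fun z => ‖charFun β z‖ * ‖charFun β z‖
  have hk₀c : Continuous k₀ := by fun_prop
  have hk₀int : ∀ j : ℕ, Integrable fun z => ‖z‖ ^ j * k₀ z := by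
    intro j
    refine ((hint j).mul_const (β.real Set.univ)).mono' (by fun_prop) (ae_of_all _ fun z => ?_)
    rw [Real.norm_of_nonneg (by positivity)]
    simp only [k₀]
    rw [← mul_assoc]
    gcongr
    exact norm_charFun_le z
  have hk₀i : Integrable k₀ := by simpa using hk₀int 0
  have hpos : 0 < ∫ z, k₀ z := by
    refine integral_pos_of_integrable_nonneg_nonzero hk₀c hk₀i (fun z => by positivity)
      (x := 0) ?_
    have : NeZero β := ⟨hβ0⟩
    simp [k₀, charFun_zero, measureReal_def, ENNReal.toReal_eq_zero_iff, hβ0]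
  set c := (∫ z, k₀ z)⁻¹ with hc
  have hcpos : 0 < c := inv_pos.2 hpos
  let ν₀ := β.conv (β.map ((-1 : ℝ) • ·))
  have hν₀ : ∀ z, charFun ν₀ z = k₀ z := by
    intro z
    rw [charFun_conv, charFun_map_smul, neg_one_smul, charFun_neg, Complex.mul_conj,
      Complex.normSq_eq_norm_sq]
    simp [k₀, sq]
  refine ⟨fun z => c * k₀ z, ENNReal.ofReal c • ν₀, ?_, ?_, ?_, by fun_prop, ?_,
    hk₀i.const_mul c, ?_, ?_⟩
  · exact Measure.smul_finite _ ENNReal.ofReal_ne_top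
  · refine Measure.ae_smul_measure ?_ _
    have h2 : ∀ᵐ u ∂(β.map ((-1 : ℝ) • ·)), ‖u‖ ≤ 2 := by
      refine (ae_map_iff (by fun_prop) (measurableSet_le (by fun_prop) (by fun_prop))).2 ?_
      simpa using hβ
    refine (ae_map_iff (by fun_prop) (measurableSet_le (by fun_prop) (by fun_prop))).2 ?_
    filter_upwards [Measure.quasiMeasurePreserving_fst.ae hβ,
        Measure.quasiMeasurePreserving_snd.ae h2] with z h1 h2
    linarith [norm_add_le z.1 z.2]
  · intro z
    have : charFun (ENNReal.ofReal c • ν₀) z = c * charFun ν₀ z := by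
      simp only [charFun_apply, integral_smul_measure, ENNReal.toReal_ofReal hcpos.le,
        Complex.real_smul]
    rw [this, hν₀]
    push_cast
    rfl
  · intro z
    positivity
  · rw [integral_const_mul, hc, inv_mul_cancel₀ hpos.ne']
  · refine ((hk₀int 1).const_mul c).congr (ae_of_all _ fun z => ?_)
    simp only [pow_one]
    ring

end Kernel

/-! ### From characteristic functions to transport cost -/

section Smoothing

variable {E : Type*} [NormedAddCommGroup E] [InnerProductSpace ℝ E] [FiniteDimensional ℝ E]
  [MeasurableSpace E] [BorelSpace E]

lemma fst_withDensity_prod {X Y : Type*} [MeasurableSpace X] [MeasurableSpace Y] {μ : Measure X}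
    {ν : Measure Y} [SFinite μ] [SFinite ν] {f : X × Y → ℝ≥0∞} (hf : Measurable f) :
    ((μ.prod ν).withDensity f).fst = μ.withDensity fun x => ∫⁻ y, f (x, y) ∂ν := by
  ext A hA
  rw [Measure.fst_apply hA, withDensity_apply _ (measurable_fst hA), withDensity_apply _ hA,
    ← Set.prod_univ, ← Measure.prod_restrict, Measure.restrict_univ,
    lintegral_prod _ hf.aemeasurable]

lemma snd_withDensity_prod {X Y : Type*} [MeasurableSpace X] [MeasurableSpace Y] {μ : Measure X}
    {ν : Measure Y} [SFinite μ] [SFinite ν] {f : X × Y → ℝ≥0∞} (hf : Measurable f) :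
    ((μ.prod ν).withDensity f).snd = ν.withDensity fun y => ∫⁻ x, f (x, y) ∂μ := by
  ext A hA
  rw [Measure.snd_apply hA, withDensity_apply _ (measurable_snd hA), withDensity_apply _ hA,
    ← Set.univ_prod, ← Measure.prod_restrict, Measure.restrict_univ,
    lintegral_prod_symm _ hf.aemeasurable]

/-- Fubini for a translate of a characteristic function. -/
lemma integral_charFun_smul_sub (P ν : Measure E) [IsFiniteMeasure P] [IsFiniteMeasure ν] (r : ℝ)
    (y : E) : ∫ x, charFun ν (r • (y - x)) ∂P =
      ∫ u, Complex.exp (inner ℝ u (r • y) * Complex.I) * charFun P (-(r • u)) ∂ν := by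
  simp only [charFun_apply]
  rw [integral_integral_swap]
  · refine integral_congr_ae (ae_of_all _ fun u => ?_)
    simp only
    rw [← integral_const_mul]
    refine integral_congr_ae (ae_of_all _ fun x => ?_)
    simp only
    rw [← Complex.exp_add, ← add_mul, ← Complex.ofReal_add]
    rw [smul_sub, inner_sub_right, inner_neg_right, inner_smul_right x u, inner_smul_right u x,
      real_inner_comm x u, sub_eq_add_neg]
  · refine Integrable.of_bound (C := 1) (by fun_prop) (ae_of_all _ fun z => ?_)
    exact (Complex.norm_exp_ofReal_mul_I _).le

/-- After Fubini, only the frequencies `-(r • u)` with `u` in the bounded support of `ν` enter. -/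
lemma norm_integral_charFun_sub_le {P P' ν : Measure E} [IsProbabilityMeasure P]
    [IsProbabilityMeasure P'] [IsFiniteMeasure ν] {L r D : ℝ} (hr : 0 ≤ r)
    (hν : ∀ᵐ u ∂ν, ‖u‖ ≤ L)
    (hD : ∀ ξ : E, ‖ξ‖ ≤ r * L → ‖charFun P ξ - charFun P' ξ‖ ≤ D) (y : E) :
    ‖∫ x, charFun ν (r • (y - x)) ∂P - ∫ x, charFun ν (r • (y - x)) ∂P'‖ ≤
      D * ν.real Set.univ := by
  have hi : ∀ (Q : Measure E) [IsProbabilityMeasure Q], Integrable (fun u : E =>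
      Complex.exp (inner ℝ u (r • y) * Complex.I) * charFun Q (-(r • u))) ν := by
    intro Q _
    have hm : Measurable (charFun Q) := measurable_charFun
    refine Integrable.of_bound (C := 1) (Measurable.aestronglyMeasurable ?_)
      (ae_of_all _ fun u => ?_)
    · exact (by fun_prop : Measurable fun u : E =>
        Complex.exp (inner ℝ u (r • y) * Complex.I)).mul (hm.comp (by fun_prop))
    · rw [norm_mul, Complex.norm_exp_ofReal_mul_I, one_mul]
      exact norm_charFun_le_one _
  rw [integral_charFun_smul_sub, integral_charFun_smul_sub, ← integral_sub (hi P) (hi P')]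
  refine norm_integral_le_of_norm_le_const ?_
  filter_upwards [hν] with u hu
  rw [← mul_sub, norm_mul, Complex.norm_exp_ofReal_mul_I, one_mul]
  refine hD _ ?_
  rw [norm_neg, norm_smul, Real.norm_of_nonneg hr]
  exact mul_le_mul_of_nonneg_left hu hr

lemma lintegral_comp_inv_smul {f : E → ℝ≥0∞} (hf : Measurable f) {h : ℝ} (hh : 0 < h) :
    ∫⁻ z, f (h⁻¹ • z) = ENNReal.ofReal (h ^ Module.finrank ℝ E) * ∫⁻ z, f z := by
  have hi : h⁻¹ ≠ 0 := inv_ne_zero hh.ne'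
  rw [← lintegral_map hf (by fun_prop), Measure.map_addHaar_smul _ hi, lintegral_smul_measure,
    inv_pow, inv_inv, abs_of_pos (by positivity), smul_eq_mul]

/-- The joint law of `(X + hZ, X)` for `X` of law `P` and independent `Z` of density `k`. -/
noncomputable def smoothedJoint (k : E → ℝ) (h : ℝ) (P : Measure E) : Measure (E × E) :=
  ((volume : Measure E).prod P).withDensity fun z =>
    ENNReal.ofReal ((h ^ Module.finrank ℝ E)⁻¹ * k (h⁻¹ • (z.1 - z.2)))

lemma smoothedJoint_fst {k : E → ℝ} (hkc : Continuous k) {h : ℝ} (P : Measure E)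
    [IsProbabilityMeasure P] :
    (smoothedJoint k h P).fst = volume.withDensity fun y =>
    ∫⁻ x, ENNReal.ofReal ((h ^ Module.finrank ℝ E)⁻¹ * k (h⁻¹ • (y - x))) ∂P :=
  fst_withDensity_prod (by fun_prop)

lemma smoothedJoint_snd {k : E → ℝ} (hkc : Continuous k) (hk0 : ∀ z, 0 ≤ k z)
    (hki : Integrable k) {h : ℝ} (hh : 0 < h) (P : Measure E) [IsProbabilityMeasure P]
    (hk1 : ∫ z, k z = 1) : (smoothedJoint k h P).snd = P := by
  have hd : 0 < h ^ Module.finrank ℝ E := by positivity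
  rw [smoothedJoint, snd_withDensity_prod (by fun_prop)]
  convert withDensity_one with x
  simp only
  rw [lintegral_sub_right_eq_self
    (fun z => ENNReal.ofReal ((h ^ Module.finrank ℝ E)⁻¹ * k (h⁻¹ • z))) x,
    lintegral_comp_inv_smul
      (f := fun z => ENNReal.ofReal ((h ^ Module.finrank ℝ E)⁻¹ * k z)) (by fun_prop) hh,
    ← ofReal_integral_eq_lintegral_ofReal (hki.const_mul _)
      (ae_of_all _ fun z => mul_nonneg (by positivity) (hk0 z)), integral_const_mul, hk1, mul_one,
    ← ENNReal.ofReal_mul hd.le, mul_inv_cancel₀ hd.ne', ENNReal.ofReal_one, Pi.one_apply]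

lemma lintegral_edist_smoothedJoint {k : E → ℝ} (hkc : Continuous k) (hk0 : ∀ z, 0 ≤ k z)
    {h : ℝ} (hh : 0 < h) (P : Measure E) [IsProbabilityMeasure P]
    (hk1 : Integrable fun z => ‖z‖ * k z) :
    ∫⁻ z, edist z.1 z.2 ∂(smoothedJoint k h P) = ENNReal.ofReal (h * ∫ z, ‖z‖ * k z) := by
  have hd : 0 < h ^ Module.finrank ℝ E := by positivity
  rw [smoothedJoint, lintegral_withDensity_eq_lintegral_mul _ (by fun_prop) (by fun_prop),
    lintegral_prod_symm _ (by fun_prop)]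
  have hx : ∀ x : E, ∫⁻ y, ENNReal.ofReal ((h ^ Module.finrank ℝ E)⁻¹ * k (h⁻¹ • (y - x))) *
      edist y x = ENNReal.ofReal (h * ∫ z, ‖z‖ * k z) := by
    intro x
    have e : ∀ y : E, ENNReal.ofReal ((h ^ Module.finrank ℝ E)⁻¹ * k (h⁻¹ • (y - x))) *
        edist y x = ENNReal.ofReal ((h ^ Module.finrank ℝ E)⁻¹ * h *
          (‖h⁻¹ • (y - x)‖ * k (h⁻¹ • (y - x)))) := by
      intro y
      rw [edist_dist, dist_eq_norm, ← ENNReal.ofReal_mul (mul_nonneg (by positivity) (hk0 _)),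
        norm_smul, Real.norm_of_nonneg (inv_nonneg.2 hh.le)]
      congr 1
      field_simp
    simp_rw [e]
    rw [lintegral_sub_right_eq_self (fun z => ENNReal.ofReal ((h ^ Module.finrank ℝ E)⁻¹ * h *
          (‖h⁻¹ • z‖ * k (h⁻¹ • z)))) x,
      lintegral_comp_inv_smul (f := fun z => ENNReal.ofReal ((h ^ Module.finrank ℝ E)⁻¹ * h *
          (‖z‖ * k z))) (by fun_prop) hh,
      ← ofReal_integral_eq_lintegral_ofReal (hk1.const_mul _)
      (ae_of_all _ fun z => mul_nonneg (by positivity) (mul_nonneg (norm_nonneg _) (hk0 z))),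
      integral_const_mul, ← ENNReal.ofReal_mul hd.le]
    congr 1
    field_simp
  simp only [Pi.mul_apply, hx, lintegral_const, measure_univ, mul_one]

/-- Markov's inequality: leaving radius `2 * R` from a point of norm at most `R` requires a
displacement of at least `R`. -/
lemma smoothedJoint_tail_le {k : E → ℝ} (hkc : Continuous k) (hk0 : ∀ z, 0 ≤ k z)
    {h : ℝ} (hh : 0 < h) (P : Measure E) [IsProbabilityMeasure P]
    {R : ℝ} (hR : 0 < R) (hP : ∀ᵐ x ∂P, ‖x‖ ≤ R)
    (hsnd : (smoothedJoint k h P).snd = P) (hk1 : Integrable fun z => ‖z‖ * k z) :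
    (smoothedJoint k h P).fst (Metric.closedBall 0 (2 * R))ᶜ ≤
      ENNReal.ofReal (h * (∫ z, ‖z‖ * k z) / R) := by
  rw [Measure.fst_apply Metric.isClosed_closedBall.measurableSet.compl]
  have hae : ∀ᵐ z ∂(smoothedJoint k h P), ‖z.2‖ ≤ R := by
    rw [← hsnd] at hP
    exact ae_of_ae_map measurable_snd.aemeasurable hP
  calc (smoothedJoint k h P) (Prod.fst ⁻¹' (Metric.closedBall 0 (2 * R))ᶜ)
      ≤ (smoothedJoint k h P) {z | ENNReal.ofReal R ≤ edist z.1 z.2} := by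
        refine measure_mono_ae ?_
        filter_upwards [hae] with z hz hz1
        have hz1' : 2 * R < ‖z.1‖ := by
          simpa using (show z.1 ∉ Metric.closedBall (0 : E) (2 * R) from hz1)
        show ENNReal.ofReal R ≤ edist z.1 z.2
        rw [edist_dist, dist_eq_norm]
        refine ENNReal.ofReal_le_ofReal ?_
        linarith [norm_sub_norm_le z.1 z.2]
    _ ≤ (∫⁻ z, edist z.1 z.2 ∂(smoothedJoint k h P)) / ENNReal.ofReal R :=
        meas_ge_le_lintegral_div (by fun_prop) (by simpa using hR) ENNReal.ofReal_ne_top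
    _ = _ := by
        rw [lintegral_edist_smoothedJoint hkc hk0 hh P hk1, ENNReal.ofReal_div_of_pos hR]

/-- A smoothing inequality: the transport cost between measures on a ball is controlled by the
difference of their characteristic functions at frequencies up to `4 / h`. -/
lemma exists_coupling_of_charFun_close (E : Type*) [NormedAddCommGroup E] [InnerProductSpace ℝ E]
    [FiniteDimensional ℝ E] [MeasurableSpace E] [BorelSpace E] {R : ℝ} (hR : 0 < R) :
    ∃ m K : ℝ, 0 < m ∧ 0 < K ∧ ∀ (P P' : Measure E), IsProbabilityMeasure P →
      IsProbabilityMeasure P' → (∀ᵐ x ∂P, ‖x‖ ≤ R) → (∀ᵐ x ∂P', ‖x‖ ≤ R) →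
      ∀ h D : ℝ, 0 < h → 0 ≤ D →
      (∀ ξ : E, ‖ξ‖ ≤ h⁻¹ * 4 → ‖charFun P ξ - charFun P' ξ‖ ≤ D) →
      ∃ π : Measure (E × E), π.fst = P ∧ π.snd = P' ∧
        ∫⁻ z, edist z.1 z.2 ∂π ≤
          ENNReal.ofReal (m * h + K * ((h ^ Module.finrank ℝ E)⁻¹ * D)) := by
  obtain ⟨k, ν, hνfin, hν, hkν, hkc, hk0, hki, hk1, hkm⟩ := exists_bandlimited_density E
  set m₁ := ∫ z, ‖z‖ * k z
  have hm₁ : 0 ≤ m₁ := integral_nonneg fun z => mul_nonneg (norm_nonneg _) (hk0 z)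
  set vol := (volume : Measure E).real (Metric.closedBall 0 (2 * R))
  -- The `4 * m₁` is one `m₁` for each smoothing plus `2 * R * (m₁ / R)` from the tail; the `+ 1`s
  -- ensure positivity.
  refine ⟨4 * m₁ + 1, 2 * R * (vol * ν.real Set.univ) + 1, by positivity, by positivity, ?_⟩
  intro P P' _ _ hP hP' h D hh hD0 hD
  have hd : 0 < h ^ Module.finrank ℝ E := by positivity
  set c := (h ^ Module.finrank ℝ E)⁻¹ with hc
  have hc0 : 0 < c := inv_pos.2 hd
  have hs := smoothedJoint_snd hkc hk0 hki hh P hk1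
  have hs' := smoothedJoint_snd hkc hk0 hki hh P' hk1
  have hp : IsProbabilityMeasure (smoothedJoint k h P) :=
    ⟨by rw [← Measure.snd_univ, hs, measure_univ]⟩
  have hp' : IsProbabilityMeasure (smoothedJoint k h P') :=
    ⟨by rw [← Measure.snd_univ, hs', measure_univ]⟩
  let q : Measure E → E → ℝ≥0∞ := fun Q y => ∫⁻ x, ENNReal.ofReal (c * k (h⁻¹ • (y - x))) ∂Q
  have hqm : ∀ (Q : Measure E) [IsProbabilityMeasure Q], Measurable (q Q) := fun Q _ =>
    Measurable.lintegral_prod_right' (f := fun z : E × E =>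
      ENNReal.ofReal (c * k (h⁻¹ • (z.1 - z.2)))) (by fun_prop)
  obtain ⟨π, h1, h2, h3⟩ := exists_coupling_of_density (hqm P) (hqm P')
    (smoothedJoint_fst hkc P) (smoothedJoint_fst hkc P') (by rw [hs]; exact hP)
    (by rw [hs']; exact hP')
  refine ⟨π, h1.trans hs, h2.trans hs', h3.trans ?_⟩
  rw [lintegral_edist_smoothedJoint hkc hk0 hh P hkm,
    lintegral_edist_smoothedJoint hkc hk0 hh P' hkm]
  have hq : ∀ (Q : Measure E) [IsProbabilityMeasure Q] (y : E),
      q Q y = ENNReal.ofReal (c * ∫ x, k (h⁻¹ • (y - x)) ∂Q) := by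
    intro Q _ y
    have hb : ∀ z, ‖k z‖ ≤ ν.real Set.univ := fun z => by
      rw [← Complex.norm_real, hkν]
      exact norm_charFun_le z
    rw [← integral_const_mul, ofReal_integral_eq_lintegral_ofReal]
    · exact (Integrable.of_bound (C := ν.real Set.univ)
        (by fun_prop) (ae_of_all _ fun x => hb _)).const_mul c
    · exact ae_of_all _ fun x => mul_nonneg hc0.le (hk0 _)
  have hdiff : ∀ y, q P y - q P' y ≤ ENNReal.ofReal (c * (D * ν.real Set.univ)) := by
    intro y
    rw [hq, hq, ← ENNReal.ofReal_sub _
      (mul_nonneg hc0.le (integral_nonneg fun x => hk0 _)), ← mul_sub]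
    refine ENNReal.ofReal_le_ofReal (mul_le_mul_of_nonneg_left ?_ hc0.le)
    refine (le_abs_self _).trans ?_
    have := norm_integral_charFun_sub_le (inv_nonneg.2 hh.le) hν hD y
    simp only [← hkν, integral_complex_ofReal, ← Complex.ofReal_sub, Complex.norm_real] at this
    exact this
  -- The pointwise bound is integrable only over a bounded set; outside the ball the tail of `q P`
  -- alone suffices.
  have hint : ∫⁻ y, q P y - q P' y ≤
      ENNReal.ofReal (c * (D * ν.real Set.univ) * vol + h * m₁ / R) := by
    rw [← lintegral_add_compl _
      (Metric.isClosed_closedBall (x := (0 : E)) (ε := 2 * R)).measurableSet,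
      ENNReal.ofReal_add (by positivity) (by positivity)]
    refine add_le_add ?_ ?_
    · calc ∫⁻ y in Metric.closedBall 0 (2 * R), q P y - q P' y
          ≤ ∫⁻ _ in Metric.closedBall (0 : E) (2 * R),
              ENNReal.ofReal (c * (D * ν.real Set.univ)) := lintegral_mono hdiff
        _ = _ := by
          rw [setLIntegral_const, ENNReal.ofReal_mul (q := vol) (by positivity),
            ofReal_measureReal measure_closedBall_lt_top.ne]
    · calc ∫⁻ y in (Metric.closedBall 0 (2 * R))ᶜ, q P y - q P' y
          ≤ ∫⁻ y in (Metric.closedBall 0 (2 * R))ᶜ, q P y := lintegral_mono fun y => tsub_le_self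
        _ = (smoothedJoint k h P).fst (Metric.closedBall 0 (2 * R))ᶜ := by
          rw [smoothedJoint_fst hkc,
            withDensity_apply _ Metric.isClosed_closedBall.measurableSet.compl]
        _ ≤ _ := smoothedJoint_tail_le hkc hk0 hh P hR hP hs hkm
  calc _ ≤ ENNReal.ofReal (h * m₁) + ENNReal.ofReal (h * m₁) + ENNReal.ofReal (2 * R) *
        ENNReal.ofReal (c * (D * ν.real Set.univ) * vol + h * m₁ / R) := by gcongr
    _ = ENNReal.ofReal (h * m₁ + h * m₁ +
        2 * R * (c * (D * ν.real Set.univ) * vol + h * m₁ / R)) := by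
      rw [← ENNReal.ofReal_mul (by positivity), ← ENNReal.ofReal_add (by positivity)
        (by positivity), ← ENNReal.ofReal_add (by positivity) (by positivity)]
    _ ≤ _ := by
      refine ENNReal.ofReal_le_ofReal ?_
      have e : h * m₁ + h * m₁ + 2 * R * (c * (D * ν.real Set.univ) * vol + h * m₁ / R) =
          4 * m₁ * h + 2 * R * (vol * ν.real Set.univ) * (c * D) := by
        field_simp
        ring
      have : 0 ≤ c * D := by positivity
      rw [e]
      nlinarith

end Smoothing

/-! ### Fourier transform of the mixture and deconvolution -/

section Mixture

variable {d : ℕ} {𝒮 : Set (Matrix (Fin d) (Fin d) ℝ)}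
  {f : Space d → Space d → Matrix (Fin d) (Fin d) ℝ → ℝ}

/-- A non-integrable function has Bochner integral `0`, not `1`. -/
lemma IsDensityKernel.integrable (hf : IsDensityKernel 𝒮 f) {S : Matrix (Fin d) (Fin d) ℝ}
    (hS : S ∈ 𝒮) : Integrable fun x => f x 0 S :=
  Integrable.of_integral_ne_zero (by rw [hf.integral_eq_one S hS]; exact one_ne_zero)

lemma IsDensityKernel.integrable_prod (hf : IsDensityKernel 𝒮 f)
    {S : Matrix (Fin d) (Fin d) ℝ} (hS : S ∈ 𝒮) (P : Measure (Space d)) [IsProbabilityMeasure P] :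
    Integrable (fun z : Space d × Space d => f z.1 z.2 S) ((volume : Measure (Space d)).prod P) := by
  have hm := hf.measurable S hS
  have e : (fun z : Space d × Space d => f z.1 z.2 S) = fun z => f (z.1 - z.2) 0 S :=
    funext fun z => hf.location S hS z.1 z.2
  rw [e]
  refine (integrable_prod_iff' ?_).2 ⟨ae_of_all _ fun θ => ?_, ?_⟩
  · exact (hm.comp (measurable_fst.sub measurable_snd)).aestronglyMeasurable
  · exact (hf.integrable hS).comp_sub_right θ
  · simp only [integral_sub_right_eq_self (fun x => ‖f x 0 S‖)]
    exact integrable_const _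

lemma IsDensityKernel.integrable_mixtureDensity (hf : IsDensityKernel 𝒮 f)
    {S : Matrix (Fin d) (Fin d) ℝ} (hS : S ∈ 𝒮) (P : Measure (Space d)) [IsProbabilityMeasure P] :
    Integrable (mixtureDensity f P S) :=
  (hf.integrable_prod hS P).integral_prod_left

lemma norm_exp_I_mul_inner (ξ x : Space d) :
    ‖Complex.exp (Complex.I * (inner ℝ ξ x : ℝ))‖ = 1 := by
  rw [mul_comm, Complex.norm_exp_ofReal_mul_I]

lemma integrable_exp_mul_ofReal {g : Space d → ℝ} (hg : Integrable g) (ξ : Space d) :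
    Integrable fun x => Complex.exp (Complex.I * (inner ℝ ξ x : ℝ)) * (g x : ℂ) :=
  hg.ofReal.bdd_mul (c := 1) (by fun_prop) (ae_of_all _ fun x => (norm_exp_I_mul_inner ξ x).le)

lemma IsDensityKernel.integral_exp_mul_mixtureDensity (hf : IsDensityKernel 𝒮 f)
    {S : Matrix (Fin d) (Fin d) ℝ} (hS : S ∈ 𝒮) (P : Measure (Space d)) [IsProbabilityMeasure P]
    (ξ : Space d) :
    ∫ x, Complex.exp (Complex.I * (inner ℝ ξ x : ℝ)) * (mixtureDensity f P S x : ℂ) =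
      charFun P ξ * kernelCharFun f S ξ := by
  simp only [mixtureDensity, ← integral_complex_ofReal, ← integral_const_mul]
  rw [integral_integral_swap]
  · rw [charFun_apply, ← integral_mul_const]
    refine integral_congr_ae (ae_of_all _ fun θ => ?_)
    simp only [kernelCharFun]
    rw [← integral_const_mul, ← integral_sub_right_eq_self (fun x => Complex.exp (inner ℝ θ ξ * Complex.I) *
      (Complex.exp (Complex.I * (inner ℝ ξ x : ℝ)) * (f x 0 S : ℂ))) θ]
    refine integral_congr_ae (ae_of_all _ fun x => ?_)
    simp only
    rw [hf.location S hS x θ, ← mul_assoc, ← Complex.exp_add, real_inner_comm ξ θ,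
      inner_sub_right]
    congr 2
    push_cast
    ring
  · refine (hf.integrable_prod hS P).ofReal.bdd_mul (c := 1) (by fun_prop) (ae_of_all _ fun z => ?_)
    exact (norm_exp_I_mul_inner ξ z.1).le

lemma norm_charFun_mul_sub_le_l1Dist (hf : IsDensityKernel 𝒮 f)
    {S S' : Matrix (Fin d) (Fin d) ℝ} (hS : S ∈ 𝒮) (hS' : S' ∈ 𝒮) (P P' : Measure (Space d))
    [IsProbabilityMeasure P] [IsProbabilityMeasure P'] (ξ : Space d) :
    ‖charFun P ξ * kernelCharFun f S ξ - charFun P' ξ * kernelCharFun f S' ξ‖ₑ ≤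
      l1Dist (mixtureDensity f P S) (mixtureDensity f P' S') := by
  rw [← hf.integral_exp_mul_mixtureDensity hS, ← hf.integral_exp_mul_mixtureDensity hS',
    ← integral_sub (integrable_exp_mul_ofReal (hf.integrable_mixtureDensity hS P) ξ)
      (integrable_exp_mul_ofReal (hf.integrable_mixtureDensity hS' P') ξ)]
  refine (enorm_integral_le_lintegral_enorm _).trans (lintegral_mono fun x => ?_)
  rw [← mul_sub, enorm_mul, ← Complex.ofReal_sub, ← ofReal_norm (Complex.exp _),
    norm_exp_I_mul_inner, ENNReal.ofReal_one, one_mul, ← ofReal_norm (Complex.ofReal _),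
    Complex.norm_real, ofReal_norm]

end Mixture

lemma norm_mul_le_of_norm_mul_sub_mul_le {a a' b b' : ℂ} {V x : ℝ} (ha' : ‖a'‖ ≤ 1)
    (hV : ‖a * b - a' * b'‖ ≤ V) (hx : ‖b' - b‖ ≤ x) : ‖a - a'‖ * ‖b‖ ≤ V + x := by
  have e : (a - a') * b = (a * b - a' * b') + a' * (b' - b) := by ring
  rw [← norm_mul, e]
  refine (norm_add_le _ _).trans (add_le_add hV ?_)
  rw [norm_mul]
  exact (mul_le_of_le_one_left (norm_nonneg _) ha').trans hx

/-- The difference of the characteristic functions of the mixing measures, after deconvolution. -/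
lemma norm_charFun_sub_le {d : ℕ} {lmin lmax p α c₁ c₂ : ℝ} {A : ℝ≥0} {Ξ : ℝ≥0 → ℝ≥0}
    {f : Space d → Space d → Matrix (Fin d) (Fin d) ℝ → ℝ}
    (hf : IsDensityKernel (scaleSet d lmin lmax) f) (hΞ : CharFunControlled f lmin lmax p A Ξ)
    (hss : SuperSmooth f lmin lmax α c₁ c₂) (hc₁ : 0 ≤ c₁) (hp : 0 ≤ p) (hα : 0 ≤ α)
    {S S' : Matrix (Fin d) (Fin d) ℝ}
    (hS : S ∈ scaleSet d lmin lmax) (hS' : S' ∈ scaleSet d lmin lmax) {P P' : Measure (Space d)}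
    [IsProbabilityMeasure P] [IsProbabilityMeasure P'] {T : ℝ} {V : ℝ≥0}
    (hV : l1Dist (mixtureDensity f P S) (mixtureDensity f P' S') = V) {ξ : Space d}
    (hξ : ‖ξ‖ ≤ T) :
    ‖charFun P ξ - charFun P' ξ‖ ≤
      V * Real.exp (c₁ * T ^ α) + A * Ξ (opNorm (S - S')) * T ^ p := by
  have hVn : ‖charFun P ξ * kernelCharFun f S ξ - charFun P' ξ * kernelCharFun f S' ξ‖ ≤ V := by
    have h := norm_charFun_mul_sub_le_l1Dist hf hS hS' P P' ξ
    rw [hV, ← ofReal_norm, ENNReal.ofReal_le_coe] at h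
    exact h
  have hlow : ∀ s ∈ scaleSet d lmin lmax, Real.exp (-(c₁ * T ^ α)) ≤ ‖kernelCharFun f s ξ‖ := by
    intro s hs
    refine le_trans (Real.exp_le_exp.2 ?_) (hss ξ s hs).1
    rw [neg_mul]
    gcongr
  have hpow : ‖ξ‖ ^ p ≤ T ^ p := by gcongr
  -- Here `b` is the larger modulus: it cancels in the `Ξ` term, and only `V` is divided by
  -- something exponentially small.
  have key : ∀ a b : ℝ, 0 ≤ a → Real.exp (-(c₁ * T ^ α)) ≤ b →
      a * b ≤ V + A * Ξ (opNorm (S - S')) * ‖ξ‖ ^ p * b →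
      a ≤ V * Real.exp (c₁ * T ^ α) + A * Ξ (opNorm (S - S')) * T ^ p := by
    intro a b ha hb hab
    have hb0 : 0 < b := (Real.exp_pos _).trans_le hb
    have hinv : b⁻¹ ≤ Real.exp (c₁ * T ^ α) := by
      rw [Real.exp_neg] at hb
      exact inv_le_of_inv_le₀ (Real.exp_pos _) hb
    calc a = a * b * b⁻¹ := (mul_inv_cancel_right₀ hb0.ne' a).symm
      _ ≤ (V + A * Ξ (opNorm (S - S')) * ‖ξ‖ ^ p * b) * b⁻¹ := by gcongr
      _ = V * b⁻¹ + A * Ξ (opNorm (S - S')) * ‖ξ‖ ^ p := by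
        rw [add_mul, mul_inv_cancel_right₀ hb0.ne']
      _ ≤ _ := by gcongr
  have hx := hΞ.2 ξ S hS S' hS'
  rcases le_total ‖kernelCharFun f S' ξ‖ ‖kernelCharFun f S ξ‖ with h | h
  · rw [max_eq_right h] at hx
    exact key _ _ (norm_nonneg _) (hlow S hS)
      (norm_mul_le_of_norm_mul_sub_mul_le (norm_charFun_le_one ξ) hVn hx)
  · rw [max_eq_left h] at hx
    rw [norm_sub_rev] at hx hVn ⊢
    exact key _ _ (norm_nonneg _) (hlow S' hS')
      (norm_mul_le_of_norm_mul_sub_mul_le (norm_charFun_le_one ξ) hVn hx)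

/-! ### Absorbing powers into exponentials -/

section Rates

lemma exists_rpow_le_mul_exp {s : ℝ} (hs : 0 ≤ s) :
    ∃ c : ℝ, 0 < c ∧ ∀ x : ℝ, 0 < x → x ^ s ≤ c * Real.exp x := by
  refine ⟨(⌈s⌉₊.factorial : ℝ), by positivity, fun x hx => ?_⟩
  have hf : (1 : ℝ) ≤ (⌈s⌉₊.factorial : ℝ) := by
    exact_mod_cast Nat.one_le_iff_ne_zero.2 (Nat.factorial_ne_zero _)
  rcases le_total x 1 with h1 | h1
  · calc x ^ s ≤ 1 := Real.rpow_le_one hx.le h1 hs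
      _ ≤ _ := one_le_mul_of_one_le_of_one_le hf (Real.one_le_exp hx.le)
  · calc x ^ s ≤ x ^ (⌈s⌉₊ : ℝ) := Real.rpow_le_rpow_of_exponent_le h1 (Nat.le_ceil s)
      _ = x ^ ⌈s⌉₊ := Real.rpow_natCast _ _
      _ ≤ _ := (div_le_iff₀' (by positivity)).1 (Real.pow_div_factorial_le_exp x hx.le _)

/-- Substitute `x = 1 / w ^ α` and `s = m / α` in the previous bound and invert. -/
lemma exists_exp_neg_inv_rpow_le {α : ℝ} (hα : 0 < α) {m : ℝ} (hm : 0 ≤ m) :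
    ∃ c : ℝ, 0 < c ∧ ∀ w : ℝ, 0 < w → c * Real.exp (-(1 / w ^ α)) ≤ w ^ m := by
  obtain ⟨c, hc, h⟩ := exists_rpow_le_mul_exp (div_nonneg hm hα.le)
  refine ⟨c⁻¹, inv_pos.2 hc, fun w hw => ?_⟩
  have h1 := h (1 / w ^ α) (by positivity)
  have e : (1 / w ^ α) ^ (m / α) = (w ^ m)⁻¹ := by
    rw [one_div, Real.inv_rpow (by positivity), ← Real.rpow_mul hw.le, mul_div_cancel₀ _ hα.ne']
  rw [e] at h1
  rw [Real.exp_neg, ← mul_inv]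
  exact inv_le_of_inv_le₀ (by positivity) h1

/-- If a power of `w` is bounded by a sum, then one of the two terms is exponentially large. -/
lemma exists_exp_le_or_exp_le {α : ℝ} (hα : 0 < α) {p c k L A : ℝ} (hp : 0 ≤ p) (hc : 0 < c)
    (hk : 0 < k) (hL : 0 < L) (hA : 0 < A) (n : ℕ) :
    ∃ C k₁ k₂ : ℝ, 0 < C ∧ 0 < k₁ ∧ 0 < k₂ ∧ ∀ w V X : ℝ, 0 < w →
      k * w ^ n ≤ V * Real.exp (c * (L / w) ^ α) + A * X * (L / w) ^ p →
      k₁ * Real.exp (-(C / w ^ α)) ≤ V ∨ k₂ * Real.exp (-(C / w ^ α)) ≤ X := by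
  obtain ⟨b₁, hb₁, h₁⟩ := exists_exp_neg_inv_rpow_le hα (m := n) (by positivity)
  obtain ⟨b₂, hb₂, h₂⟩ := exists_exp_neg_inv_rpow_le hα (m := n + p) (by positivity)
  -- In the exponent, `c * L ^ α` offsets the growth factor of `V` and the `1` pays for the powers
  -- of `w`.
  refine ⟨c * L ^ α + 1, k / 2 * b₁, k / (2 * A * L ^ p) * b₂, by positivity, by positivity,
    by positivity, fun w V X hw h => ?_⟩
  have hexp : Real.exp (-((c * L ^ α + 1) / w ^ α)) =
      Real.exp (-(1 / w ^ α)) * Real.exp (-(c * (L / w) ^ α)) := by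
    rw [← Real.exp_add, Real.div_rpow hL.le hw.le]
    congr 1
    ring
  have hle : Real.exp (-((c * L ^ α + 1) / w ^ α)) ≤ Real.exp (-(1 / w ^ α)) := by
    rw [hexp]
    refine mul_le_of_le_one_right (Real.exp_pos _).le (Real.exp_le_one_iff.2 ?_)
    have : 0 ≤ c * (L / w) ^ α := by positivity
    linarith
  rcases le_total (k / 2 * w ^ n) (V * Real.exp (c * (L / w) ^ α)) with hV | hV
  · left
    have h1 := h₁ w hw
    rw [Real.rpow_natCast] at h1
    calc k / 2 * b₁ * Real.exp (-((c * L ^ α + 1) / w ^ α))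
        = k / 2 * (b₁ * Real.exp (-(1 / w ^ α))) * Real.exp (-(c * (L / w) ^ α)) := by
          rw [hexp]; ring
      _ ≤ k / 2 * w ^ n * Real.exp (-(c * (L / w) ^ α)) := by gcongr
      _ ≤ V * Real.exp (c * (L / w) ^ α) * Real.exp (-(c * (L / w) ^ α)) := by gcongr
      _ = V := by rw [mul_assoc, ← Real.exp_add, add_neg_cancel, Real.exp_zero, mul_one]
  · right
    have hX : k / 2 * w ^ n ≤ A * X * (L / w) ^ p := by linarith
    rw [Real.div_rpow hL.le hw.le, mul_div_assoc', le_div_iff₀ (by positivity)] at hX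
    have h2 := h₂ w hw
    rw [Real.rpow_add hw, Real.rpow_natCast] at h2
    calc k / (2 * A * L ^ p) * b₂ * Real.exp (-((c * L ^ α + 1) / w ^ α))
        ≤ k / (2 * A * L ^ p) * b₂ * Real.exp (-(1 / w ^ α)) := by gcongr
      _ = k / (2 * A * L ^ p) * (b₂ * Real.exp (-(1 / w ^ α))) := by ring
      _ ≤ k / (2 * A * L ^ p) * (w ^ n * w ^ p) := by gcongr
      _ = (k / 2 * w ^ n * w ^ p) / (A * L ^ p) := by field_simp
      _ ≤ (A * X * L ^ p) / (A * L ^ p) := by gcongr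
      _ = X := by field_simp

end Rates

/-! ### Assembly of the lower bound -/

lemma wasserstein1_le {d : ℕ} {P P' : Measure (Space d)} {π : Measure (Space d × Space d)}
    (h : π.fst = P) (h' : π.snd = P') {b : ℝ} (hb : 0 ≤ b)
    (hπ : ∫⁻ z, edist z.1 z.2 ∂π ≤ ENNReal.ofReal b) : (wasserstein1 P P' : ℝ) ≤ b := by
  refine ENNReal.toReal_le_of_le_ofReal hb (le_trans ?_ hπ)
  exact iInf₂_le π ⟨h, h'⟩

lemma MemMixing.ae_norm_le {d : ℕ} {𝒳 : Set (Space d)} {lmin lmax R : ℝ} {P : Measure (Space d)}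
    {S : Matrix (Fin d) (Fin d) ℝ} (h : MemMixing 𝒳 lmin lmax P S)
    (h𝒳 : 𝒳 ⊆ Metric.closedBall 0 R) : ∀ᵐ x ∂P, ‖x‖ ≤ R := by
  filter_upwards [Measure.support_mem_ae (μ := P)] with x hx
  simpa using h𝒳 (h.2.1 hx)

lemma genInv_le {Ξ : ℝ≥0 → ℝ≥0} {y t : ℝ≥0} (h : y ≤ Ξ t) : genInv Ξ y ≤ t :=
  iInf₂_le t h

lemma extendTop_le {Ψ : ℝ≥0 → ℝ≥0} (hΨ : Monotone Ψ) {s : ℝ≥0∞} {t : ℝ≥0} (h : s ≤ t) :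
    extendTop Ψ s ≤ Ψ t := by
  have hs : s ≠ ∞ := ne_top_of_le_ne_top ENNReal.coe_ne_top h
  rw [extendTop, if_neg hs, ENNReal.coe_le_coe]
  exact hΨ (ENNReal.toNNReal_mono ENNReal.coe_ne_top h)

theorem theorem3p2 (d : ℕ) (R lmin lmax p α c₁ c₂ : ℝ) (A₁ A₂ : ℝ≥0)
    (hR : 0 < R) (hlmin : 0 < lmin) (hl : lmin < lmax) (hp : 1 ≤ p) (hα : 0 < α)
    (hc₁ : 0 < c₁) (hc₂ : 0 < c₂) (hA₁ : 0 < A₁) (hA₂ : 0 < A₂) :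
    ∃ C Ctilde C' : ℝ≥0, 0 < C ∧ 0 < Ctilde ∧ 0 < C' ∧
      ∀ (f : Space d → Space d → Matrix (Fin d) (Fin d) ℝ → ℝ) (𝒳 : Set (Space d))
        (Ψ Ξ : ℝ≥0 → ℝ≥0),
        IsDensityKernel (scaleSet d lmin lmax) f →
        MeasurableSet 𝒳 → 𝒳 ⊆ Metric.closedBall 0 R →
        ScaleIdentifiable f 𝒳 lmin lmax A₁ Ψ →
        CharFunControlled f lmin lmax p A₂ Ξ →
        SuperSmooth f lmin lmax α c₁ c₂ →
        ∀ (P P' : Measure (Space d)) (S S' : Matrix (Fin d) (Fin d) ℝ),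
          MemMixing 𝒳 lmin lmax P S → MemMixing 𝒳 lmin lmax P' S' →
          (C' : ℝ≥0∞) * (Ψ (opNorm (S - S')) +
              min (expRate C α (wasserstein1 P P') : ℝ≥0∞)
                ((extendTop Ψ ∘ genInv Ξ) (Ctilde * expRate C α (wasserstein1 P P'))))
            ≤ l1Dist (mixtureDensity f P S) (mixtureDensity f P' S') := by
  obtain ⟨m, K, hm, hK, hsmooth⟩ := exists_coupling_of_charFun_close (Space d) hR
  have hp0 : 0 ≤ p := zero_le_one.trans hp
  -- With `h = w / (2 * m)` the cutoff `4 / h` is `8 * m / w`, and `w / 2 ≤ K * h^{-d} * D` yields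
  -- this `k` and the power `d + 1`.
  obtain ⟨C, k₁, k₂, hC, hk₁, hk₂, hrate⟩ := exists_exp_le_or_exp_le hα (p := p) (c := c₁)
    (k := (2 * K * (2 * m) ^ d)⁻¹) (L := 8 * m) (A := A₂) hp0 hc₁ (by positivity)
    (by positivity) (by exact_mod_cast hA₂) (d + 1)
  lift C to ℝ≥0 using hC.le
  lift k₁ to ℝ≥0 using hk₁.le
  lift k₂ to ℝ≥0 using hk₂.le
  rw [NNReal.coe_pos] at hC hk₁ hk₂
  -- The `/ 2` averages the separate lower bounds by `Ψ` and by the minimum.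
  refine ⟨C, k₂, min A₁ k₁ / 2, hC, hk₂, half_pos (lt_min hA₁ hk₁), ?_⟩
  intro f 𝒳 Ψ Ξ hf _ h𝒳 hΨ hΞ hss P P' S S' hG hG'
  set w := wasserstein1 P P' with hw
  set δ := opNorm (S - S')
  have hΨV := hΨ.2 P P' S S' hG hG'
  suffices hmin : ((min A₁ k₁ : ℝ≥0) : ℝ≥0∞) * min (expRate C α w : ℝ≥0∞)
      ((extendTop Ψ ∘ genInv Ξ) (k₂ * expRate C α w)) ≤
        l1Dist (mixtureDensity f P S) (mixtureDensity f P' S') by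
    have hΨV' : ((min A₁ k₁ : ℝ≥0) : ℝ≥0∞) * Ψ δ ≤
        l1Dist (mixtureDensity f P S) (mixtureDensity f P' S') :=
      le_trans (by gcongr; exact min_le_left _ _) hΨV
    rw [ENNReal.coe_div two_ne_zero, ENNReal.coe_ofNat, ← ENNReal.mul_div_right_comm, mul_add]
    refine ENNReal.div_le_of_le_mul ?_
    rw [mul_two]
    exact add_le_add hΨV' hmin
  rcases eq_or_ne (l1Dist (mixtureDensity f P S) (mixtureDensity f P' S')) ∞ with htop | htop
  · rw [htop]; exact le_top
  obtain ⟨V, hV⟩ : ∃ V : ℝ≥0, (V : ℝ≥0∞) = l1Dist (mixtureDensity f P S)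
      (mixtureDensity f P' S') := WithTop.ne_top_iff_exists.1 htop
  rcases eq_or_ne w 0 with hw0 | hw0
  · simp [expRate, hw0]
  have hwpos : 0 < (w : ℝ) := NNReal.coe_pos.2 (pos_iff_ne_zero.2 hw0)
  have := hG.1
  have := hG'.1
  set h : ℝ := w / (2 * m) with hh
  have hhpos : 0 < h := by positivity
  have hT : h⁻¹ * 4 = 8 * m / w := by rw [hh]; field_simp; norm_num
  set D : ℝ := V * Real.exp (c₁ * (8 * m / w) ^ α) + A₂ * Ξ δ * (8 * m / w) ^ p with hD
  have hD0 : 0 ≤ D := by positivity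
  obtain ⟨π, h1, h2, h3⟩ := hsmooth P P' hG.1 hG'.1 (hG.ae_norm_le h𝒳) (hG'.ae_norm_le h𝒳) h D
    hhpos hD0 fun ξ hξ => norm_charFun_sub_le hf hΞ hss hc₁.le hp0 hα.le hG.2.2 hG'.2.2 hV.symm
      (hξ.trans_eq hT)
  have hW := wasserstein1_le h1 h2 (by positivity) h3
  rw [← hw, finrank_euclideanSpace_fin] at hW
  have hlow : (2 * K * (2 * m) ^ d)⁻¹ * (w : ℝ) ^ (d + 1) ≤ D := by
    have e1 : m * h = w / 2 := by rw [hh]; field_simp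
    have e2 : (h ^ d)⁻¹ = (2 * m) ^ d / (w : ℝ) ^ d := by rw [hh, div_pow, inv_div]
    rw [e1, e2] at hW
    have hW2 : (w : ℝ) / 2 ≤ K * ((2 * m) ^ d / (w : ℝ) ^ d * D) := by linarith
    rw [inv_mul_le_iff₀ (by positivity), pow_succ]
    calc (w : ℝ) ^ d * w = 2 * (w : ℝ) ^ d * (w / 2) := by ring
      _ ≤ 2 * (w : ℝ) ^ d * (K * ((2 * m) ^ d / (w : ℝ) ^ d * D)) := by gcongr
      _ = _ := by field_simp
  have hexp : (expRate C α w : ℝ) = Real.exp (-(C / (w : ℝ) ^ α)) := by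
    rw [expRate, if_neg hw0, Real.coe_toNNReal _ (Real.exp_pos _).le]
  rcases hrate w V (Ξ δ) hwpos hlow with h | h
  · rw [← hexp] at h
    calc _ ≤ (k₁ : ℝ≥0∞) * expRate C α w := by
          gcongr
          · exact min_le_right _ _
          · exact min_le_left _ _
      _ ≤ _ := by rw [← hV]; exact_mod_cast h
  · rw [← hexp] at h
    -- So `δ` competes in the infimum defining `genInv`, which is therefore finite and at most `δ`.
    have hle : k₂ * expRate C α w ≤ Ξ δ := by exact_mod_cast h
    calc _ ≤ (A₁ : ℝ≥0∞) * Ψ δ := by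
          gcongr
          · exact min_le_left _ _
          · exact (min_le_right _ _).trans
              (extendTop_le hΨ.1.monotone (genInv_le hle))
      _ ≤ _ := hΨV
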